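/- Let $R$ be a (left) Noetherian ring and let $\Gamma$ be a countable discrete group equipped with a proper left-invariant metric; every subgroup of $\Gamma$ carries the restricted metric. Then $\Gamma$ is weakly coarsely coherent over $R$ if and only if the family of all finitely generated subgroups of $\Gamma$ is coarsely coherent over $R$. Here the terms have the following meaning. For a metric space $X$, a subset $S\subseteq X$ and $r\ge 0$, let $S[r]$ be the set of points at distance at most $r$ from some point of $S$, and $x[r]=\{x\}[r]$. An $X$-filtered $R$-module is an $R$-module $F$ with submodules $F(S)$, $S\subseteq X$, such that $F(S)\subseteq F(T)$ for $S\subseteq T$, $F(X)=F$, $F(\emptyset)=0$, and $F(S)$ is finitely generated for every bounded $S$. For $D,d,b\ge 0$: - $F$ is $D$-lean if, for all $S$, every $u\in F(S)$ is a finite sum $u=\sum_{x\in S}u_x$ with $u_x\in F(x[D])$; it is $D$-scattered if every $u\in F$ is a finite sum $u=\sum_{x\in X}u_x$ with $u_x\in F(x[D])$; it is $d$-insular if $F(S)\cap F(T)\subseteq F(S[d]\cap T[d])$ for all $S,T$. - An $R$-linear map $f\colon F\to G$ of $X$-filtered modules is $b$-bicontrolled if $f(F(S))\subseteq G(S[b])$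 and $\operatorname{im} f\cap G(S)\subseteq f(F(S[b]))$ for all $S$. - A module is lean, scattered or insular, and a map is bicontrolled, if it is so for some constant $\ge 0$. The space $X$ is weakly coarsely coherent over $R$ if, for every exact sequence $0\to E'\xrightarrow{f}E\xrightarrow{g}E''\to 0$ of $X$-filtered $R$-modules with $f,g$ bicontrolled, $E$ lean and insular, and $E''$ insular, the module $E'$ is scattered. A family $\{X_\alpha\}$ of metric spaces is coarsely coherent over $R$ if, for every collection consisting of an exact sequence $0\to E'_\alpha\xrightarrow{f_\alpha}E_\alpha\xrightarrow{g_\alpha}E''_\alpha\to 0$ of $X_\alpha$-filtered $R$-modules for each $\alpha$, such that for some constants $D,d,b\ge 0$ independent of $\alpha$ all $E_\alpha$ are $D$-lean, all $E''_\alpha$ are $d$-insular and all $f_\alpha,g_\alpha$ are $b$-bicontrolled, there is a constant $\partial\ge 0$ such that all $E'_\alpha$ are $\partial$-scattered. -/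

import Mathlib

universe u v w t

namespace CoarseCoherence

/-- The enlargement `S[r]`: the points at distance at most `r` from some point of `S`. -/
def enlarge {X : Type v} [MetricSpace X] (S : Set X) (r : ℝ) : Set X :=
  {x | ∃ y ∈ S, dist x y ≤ r}

/-- A reduced, locally finitely generated `X`-filtered `R`-module: an `R`-module `F` together with
a monotone assignment of submodules `F(S)` to subsets `S` of `X`, with `F(X) = F`, `F(∅) = 0`, and
with `F(S)` finitely generated for bounded `S`. -/
structure FilteredModule (R : Type u) [Ring R] (X : Type v) [MetricSpace X] where
  carrier : Type w
  [addCommGroup : AddCommGroup carrier]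
  [module : Module R carrier]
  fil : Set X → Submodule R carrier
  fil_mono : ∀ S T : Set X, S ⊆ T → fil S ≤ fil T
  fil_univ : fil Set.univ = ⊤
  fil_empty : fil ∅ = ⊥
  fil_fg : ∀ S : Set X, Bornology.IsBounded S → (fil S).FG

attribute [instance] FilteredModule.addCommGroup FilteredModule.module

section

variable {R : Type u} [Ring R] {X : Type v} [MetricSpace X]

/-- `F` is `D`-lean: every `u ∈ F(S)` is a finite sum `∑_{x ∈ S} u_x` with `u_x ∈ F(x[D])`. -/
def FilteredModule.LeanWith (F : FilteredModule.{u, v, w} R X) (D : ℝ) : Prop :=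
  ∀ S : Set X, ∀ m ∈ F.fil S, ∃ c : X →₀ F.carrier,
    (∀ x ∈ c.support, x ∈ S) ∧ (∀ x, c x ∈ F.fil (enlarge {x} D)) ∧ m = c.sum fun _ n => n

/-- `F` is `D`-scattered: every `u ∈ F` is a finite sum `∑_{x ∈ X} u_x` with `u_x ∈ F(x[D])`. -/
def FilteredModule.ScatteredWith (F : FilteredModule.{u, v, w} R X) (D : ℝ) : Prop :=
  ∀ m : F.carrier, ∃ c : X →₀ F.carrier,
    (∀ x, c x ∈ F.fil (enlarge {x} D)) ∧ m = c.sum fun _ n => n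

/-- `F` is `d`-insular: an element of both `F(S)` and `F(T)` lies in `F(S[d] ∩ T[d])`. -/
def FilteredModule.InsularWith (F : FilteredModule.{u, v, w} R X) (d : ℝ) : Prop :=
  ∀ S T : Set X, ∀ m, m ∈ F.fil S → m ∈ F.fil T → m ∈ F.fil (enlarge S d ∩ enlarge T d)

/-- `f` is `b`-bicontrolled: `f(F(S)) ⊆ G(S[b])` and `im f ∩ G(S) ⊆ f(F(S[b]))` for all `S`. -/
def IsBicontrolled (F G : FilteredModule.{u, v, w} R X) (f : F.carrier →ₗ[R] G.carrier)
    (b : ℝ) : Prop :=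
  (∀ S : Set X, ∀ m ∈ F.fil S, f m ∈ G.fil (enlarge S b)) ∧
  (∀ S : Set X, ∀ y ∈ G.fil S, y ∈ LinearMap.range f → ∃ m ∈ F.fil (enlarge S b), f m = y)

end

/-- An exact sequence `0 → E' → E → E'' → 0` of `X`-filtered `R`-modules. -/
structure ShortExactSeq (R : Type u) [Ring R] (X : Type v) [MetricSpace X] where
  E' : FilteredModule.{u, v, w} R X
  E : FilteredModule.{u, v, w} R X
  E'' : FilteredModule.{u, v, w} R X
  f : E'.carrier →ₗ[R] E.carrier
  g : E.carrier →ₗ[R] E''.carrier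
  injective : Function.Injective f
  exact : Function.Exact f g
  surjective : Function.Surjective g

/-- `X` is weakly coarsely coherent (over `R`): in every exact sequence of `X`-filtered
`R`-modules with bicontrolled maps, if `E` is lean and insular and `E''` is insular, then `E'`
is scattered. -/
def WeaklyCoarselyCoherent (R : Type u) [Ring R] (X : Type v) [MetricSpace X] : Prop :=
  ∀ 𝓔 : ShortExactSeq.{u, v, w} R X,
    (∃ b : ℝ, 0 ≤ b ∧ IsBicontrolled 𝓔.E' 𝓔.E 𝓔.f b) →
    (∃ b : ℝ, 0 ≤ b ∧ IsBicontrolled 𝓔.E 𝓔.E'' 𝓔.g b) →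
    (∃ D : ℝ, 0 ≤ D ∧ 𝓔.E.LeanWith D) →
    (∃ d : ℝ, 0 ≤ d ∧ 𝓔.E.InsularWith d) →
    (∃ d : ℝ, 0 ≤ d ∧ 𝓔.E''.InsularWith d) →
    ∃ δ : ℝ, 0 ≤ δ ∧ 𝓔.E'.ScatteredWith δ

/-- The metric family `X` is coarsely coherent (over `R`): given one exact sequence of
`X i`-filtered `R`-modules for each index `i`, with uniform constants `D`, `d`, `b` such that all
`E i` are `D`-lean, all `E'' i` are `d`-insular and all maps are `b`-bicontrolled, all `E' i` are
`δ`-scattered for a uniform `δ`. -/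
def CoarselyCoherentFamily (R : Type u) [Ring R] {ι : Type t} (X : ι → Type v)
    [∀ i, MetricSpace (X i)] : Prop :=
  ∀ 𝓔 : ∀ i, ShortExactSeq.{u, v, w} R (X i),
    ∀ D d b : ℝ, 0 ≤ D → 0 ≤ d → 0 ≤ b →
    (∀ i, (𝓔 i).E.LeanWith D) →
    (∀ i, (𝓔 i).E''.InsularWith d) →
    (∀ i, IsBicontrolled (𝓔 i).E' (𝓔 i).E (𝓔 i).f b) →
    (∀ i, IsBicontrolled (𝓔 i).E (𝓔 i).E'' (𝓔 i).g b) →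
    ∃ δ : ℝ, 0 ≤ δ ∧ ∀ i, (𝓔 i).E'.ScatteredWith δ

end CoarseCoherence

/-! Both directions move exact sequences between `Γ` and its finitely generated subgroups; bounded
subsets of `Γ` are finite.

From `Γ` to the family: place each finitely generated `K` in `Γ` as a coset `a_K K`, so that a
bounded set meets only finitely many of these (`exists_translates`). The direct sum of the given
sequences is then locally finitely generated over `Γ` with the same constants, and a scattering
constant for the sum serves every summand, up to a factor 2. Translates exist because only finitely
many `K` have all their cosets meeting a given finite set, by Schreier's argument. Weak coherence
also wants an insular middle term; replacing `E` by the direct sum of the modules `E(x[D])`, each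
put at `x`, provides one.

From the family to `Γ`: merge all constants into `r` and let `H` be a finitely generated subgroup
containing the `r`-ball at 1. Distinct cosets `gH` are more than `r` apart, so leanness of `E` and
insularity of `E''` split `E'` into parts over the cosets (`eq_top_of_forall_comap_le`). The family
allows only one sequence per subgroup, so different cosets are assigned to different finitely
generated `K ≥ H`. There are enough of these: infinitely many if `Γ` is not finitely generated, and
otherwise `H = Γ` has a single coset. -/

namespace CoarseCoherence

/-! ### Enlargements, and leanness and scatteredness in terms of submodules. -/

section Enlarge

variable {X : Type v} [MetricSpace X]

theorem mem_enlarge_singleton {x y : X} {r : ℝ} : y ∈ enlarge {x} r ↔ dist y x ≤ r := by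
  simp [enlarge]

theorem enlarge_mono {S T : Set X} {r s : ℝ} (h : S ⊆ T) (hrs : r ≤ s) :
    enlarge S r ⊆ enlarge T s := by
  rintro x ⟨y, hy, hxy⟩
  exact ⟨y, h hy, hxy.trans hrs⟩

theorem subset_enlarge (S : Set X) {r : ℝ} (hr : 0 ≤ r) : S ⊆ enlarge S r :=
  fun x hx => ⟨x, hx, by simpa using hr⟩

theorem enlarge_enlarge_subset (S : Set X) (r s : ℝ) :
    enlarge (enlarge S r) s ⊆ enlarge S (r + s) := by
  rintro x ⟨y, ⟨z, hz, hyz⟩, hxy⟩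
  exact ⟨z, hz, by linarith [dist_triangle x y z]⟩

theorem enlarge_preimage_subset {Y : Type t} [MetricSpace Y] {i : Y → X} (hi : Isometry i)
    (S : Set X) (r : ℝ) : enlarge (i ⁻¹' S) r ⊆ i ⁻¹' enlarge S r := by
  rintro x ⟨y, hy, hxy⟩
  exact ⟨i y, hy, by rwa [hi.dist_eq]⟩

end Enlarge

namespace FilteredModule

variable {R : Type u} [Ring R] {X : Type v} [MetricSpace X]

/-- As an inclusion of submodules, leanness can be pushed through linear maps with `map` and
`comap`, without handling finite sums. -/
theorem leanWith_iff (F : FilteredModule.{u, v, w} R X) (D : ℝ) :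
    F.LeanWith D ↔ ∀ S : Set X, F.fil S ≤ ⨆ x ∈ S, F.fil (enlarge {x} D) := by
  refine forall_congr' fun S => forall_congr' fun m => forall_congr' fun _ => ?_
  rw [Submodule.mem_iSup_iff_exists_finsupp]
  constructor
  · rintro ⟨c, hS, hc, rfl⟩
    refine ⟨c, fun x => ?_, rfl⟩
    by_cases hx : x ∈ S
    · simpa [hx] using hc x
    · rw [Finsupp.notMem_support_iff.1 fun h => hx (hS x h)]
      exact zero_mem _
  · rintro ⟨c, hc, rfl⟩
    have key : ∀ x, x ∉ S → c x = 0 := fun x hx => by simpa [hx] using hc x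
    refine ⟨c, fun x hx => ?_, fun x => ?_, rfl⟩
    · by_contra h
      exact Finsupp.mem_support_iff.1 hx (key x h)
    · by_cases hx : x ∈ S
      · simpa [hx] using hc x
      · rw [key x hx]
        exact zero_mem _

theorem scatteredWith_iff (F : FilteredModule.{u, v, w} R X) (D : ℝ) :
    F.ScatteredWith D ↔ ⨆ x, F.fil (enlarge {x} D) = ⊤ := by
  rw [Submodule.eq_top_iff']
  refine forall_congr' fun m => ?_
  rw [Submodule.mem_iSup_iff_exists_finsupp]
  exact exists_congr fun c => and_congr_right fun _ => eq_comm

end FilteredModule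

/-- A submodule of a direct sum which is given componentwise by finitely generated submodules,
all but finitely many of them zero, is finitely generated. -/
theorem fg_of_componentwise {R : Type u} [Ring R] {ι : Type t} {M : ι → Type w}
    [∀ j, AddCommGroup (M j)] [∀ j, Module R (M j)] (N : ∀ j, Submodule R (M j))
    (P : Submodule R (Π₀ j, M j)) (hP : ∀ c, c ∈ P ↔ ∀ j, c j ∈ N j)
    (hN : ∀ j, (N j).FG) (hfin : {j | N j ≠ ⊥}.Finite) : P.FG := by
  classical
  have : P = ⨆ j ∈ hfin.toFinset, (N j).map (DFinsupp.lsingle j) := by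
    apply le_antisymm
    · intro c hc
      rw [← DFinsupp.sum_single (f := c)]
      refine Submodule.sum_mem _ fun j hj => ?_
      have hj' : j ∈ hfin.toFinset := by
        simp only [Set.Finite.mem_toFinset, Set.mem_ofPred_eq]
        intro h
        have := (hP c).1 hc j
        rw [h, Submodule.mem_bot] at this
        exact (DFinsupp.mem_support_iff.1 hj) this
      exact Submodule.mem_iSup_of_mem j (Submodule.mem_iSup_of_mem hj'
        ⟨c j, (hP c).1 hc j, rfl⟩)
    · refine iSup₂_le fun j _ => ?_
      rintro _ ⟨m, hm, rfl⟩
      refine (hP _).2 fun k => ?_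
      by_cases h : j = k
      · subst h
        simpa using hm
      · simp [DFinsupp.single_apply, h]
  rw [this]
  exact Submodule.fg_biSup _ _ fun j _ => (hN j).map _

/-- Componentwise lifting along a direct sum of linear maps. -/
theorem exists_mapRange_eq {R : Type u} [Ring R] {ι : Type t} {M N : ι → Type w}
    [∀ j, AddCommGroup (M j)] [∀ j, Module R (M j)] [∀ j, AddCommGroup (N j)]
    [∀ j, Module R (N j)] (f : ∀ j, M j →ₗ[R] N j) (P : ∀ j, Submodule R (M j)) (y : Π₀ j, N j)
    (h : ∀ j, ∃ m ∈ P j, f j m = y j) :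
    ∃ c : Π₀ j, M j, (∀ j, c j ∈ P j) ∧ DFinsupp.mapRange.linearMap f c = y := by
  classical
  choose m hm hmy using h
  -- Lifts are set to zero off the support of `y`; the chosen `m j` may be nonzero for infinitely
  -- many `j`.
  refine ⟨DFinsupp.mk y.support fun j => m j, fun j => ?_, ?_⟩
  · rw [DFinsupp.mk_apply]
    split_ifs
    · exact hm j
    · exact zero_mem _
  · ext j
    rw [DFinsupp.mapRange.linearMap_apply, DFinsupp.mapRange_apply, DFinsupp.mk_apply]
    split_ifs with hj
    · exact hmy j
    · rw [map_zero, DFinsupp.notMem_support_iff.1 hj]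

/-! ### Locally finite direct sums of filtered modules. -/

section Assembly

variable {R : Type u} [Ring R] {X : Type v} [MetricSpace X] {ι : Type w} {Y : ι → Type t}
  [∀ j, MetricSpace (Y j)]

/-- The direct sum of filtered modules over spaces `Y j` which are isometrically embedded into `X`
so that a bounded subset of `X` meets only finitely many of them. -/
def assemble (F : ∀ j, FilteredModule.{u, t, w} R (Y j)) (i : ∀ j, Y j → X)
    (hi : ∀ j, Isometry (i j))
    (hfin : ∀ S : Set X, Bornology.IsBounded S → {j | (i j ⁻¹' S).Nonempty}.Finite) :
    FilteredModule.{u, v, w} R X where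
  carrier := Π₀ j, (F j).carrier
  fil S := ⨅ j, ((F j).fil (i j ⁻¹' S)).comap (DFinsupp.lapply j)
  fil_mono S T h := iInf_mono fun j => Submodule.comap_mono
    ((F j).fil_mono _ _ (Set.preimage_mono h))
  fil_univ := by simp [(F _).fil_univ]
  fil_empty := by
    rw [eq_bot_iff]
    intro c hc
    rw [Submodule.mem_bot]
    ext j
    simpa [(F _).fil_empty] using (Submodule.mem_iInf _).1 hc j
  fil_fg S hS := by
    refine fg_of_componentwise (fun j => (F j).fil (i j ⁻¹' S)) _ (fun c => by simp)
      (fun j => (F j).fil_fg _ ((hi j).antilipschitz.isBounded_preimage hS))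
      ((hfin S hS).subset fun j hj => ?_)
    by_contra h
    apply hj
    rw [Set.not_nonempty_iff_eq_empty.1 h, (F j).fil_empty]

variable (F G : ∀ j, FilteredModule.{u, t, w} R (Y j)) (i : ∀ j, Y j → X)
  (hi : ∀ j, Isometry (i j))
  (hfin : ∀ S : Set X, Bornology.IsBounded S → {j | (i j ⁻¹' S).Nonempty}.Finite)

/-- The coordinates of an element of a direct sum of filtered modules. -/
def assembleCoord (j : ι) : (assemble F i hi hfin).carrier →ₗ[R] (F j).carrier :=
  DFinsupp.lapply (M := fun j => (F j).carrier) j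

open Classical in
/-- The inclusion of a summand of a direct sum of filtered modules. -/
noncomputable def assembleSingle (j : ι) : (F j).carrier →ₗ[R] (assemble F i hi hfin).carrier :=
  DFinsupp.lsingle (M := fun j => (F j).carrier) j

theorem mem_assemble_fil {S : Set X} {c : (assemble F i hi hfin).carrier} :
    c ∈ (assemble F i hi hfin).fil S ↔
      ∀ j, assembleCoord F i hi hfin j c ∈ (F j).fil (i j ⁻¹' S) :=
  Submodule.mem_iInf
    fun j => ((F j).fil (i j ⁻¹' S)).comap (assembleCoord F i hi hfin j)

theorem assembleCoord_single (j : ι) (m : (F j).carrier) :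
    assembleCoord F i hi hfin j (assembleSingle F i hi hfin j m) = m := by
  classical
  exact DFinsupp.single_eq_same (β := fun j => (F j).carrier)

theorem assembleCoord_single_of_ne {j k : ι} (h : k ≠ j) (m : (F j).carrier) :
    assembleCoord F i hi hfin k (assembleSingle F i hi hfin j m) = 0 := by
  classical
  exact DFinsupp.single_eq_of_ne (β := fun j => (F j).carrier) h

theorem assembleSingle_mem {S : Set X} {j : ι} {m : (F j).carrier}
    (hm : m ∈ (F j).fil (i j ⁻¹' S)) :
    assembleSingle F i hi hfin j m ∈ (assemble F i hi hfin).fil S := by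
  refine (mem_assemble_fil F i hi hfin).2 fun k => ?_
  by_cases h : k = j
  · subst h
    rwa [assembleCoord_single]
  · rw [assembleCoord_single_of_ne F i hi hfin h]
    exact zero_mem _

theorem exists_eq_sum_assembleSingle (c : (assemble F i hi hfin).carrier) :
    ∃ s : Finset ι, c = ∑ j ∈ s, assembleSingle F i hi hfin j (assembleCoord F i hi hfin j c) := by
  classical
  exact ⟨DFinsupp.support (β := fun j => (F j).carrier) c,
    (DFinsupp.sum_single (β := fun j => (F j).carrier) (f := c)).symm⟩

theorem assemble_leanWith {D : ℝ} (h : ∀ j, (F j).LeanWith D) :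
    (assemble F i hi hfin).LeanWith D := by
  simp only [FilteredModule.leanWith_iff] at h ⊢
  intro S c hc
  rw [mem_assemble_fil] at hc
  obtain ⟨s, hs⟩ := exists_eq_sum_assembleSingle F i hi hfin c
  rw [hs]
  refine Submodule.sum_mem _ fun j _ => ?_
  have h2 : (⨆ y ∈ i j ⁻¹' S, (F j).fil (enlarge {y} D)) ≤
      (⨆ x ∈ S, (assemble F i hi hfin).fil (enlarge {x} D)).comap
        (assembleSingle F i hi hfin j) := by
    refine iSup₂_le fun y hy m hm => ?_
    refine Submodule.mem_iSup_of_mem (i j y) (Submodule.mem_iSup_of_mem hy ?_)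
    refine assembleSingle_mem F i hi hfin ((F j).fil_mono _ _ (fun z hz => ?_) hm)
    rw [mem_enlarge_singleton] at hz
    rwa [Set.mem_preimage, mem_enlarge_singleton, (hi j).dist_eq]
  exact h2 (h j _ (hc j))

theorem assemble_insularWith {d : ℝ} (h : ∀ j, (F j).InsularWith d) :
    (assemble F i hi hfin).InsularWith d := by
  intro S T c hS hT
  rw [mem_assemble_fil] at hS hT ⊢
  intro j
  exact (F j).fil_mono _ _ (Set.inter_subset_inter (enlarge_preimage_subset (hi j) S d)
    (enlarge_preimage_subset (hi j) T d)) (h j _ _ _ (hS j) (hT j))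

/-- A direct sum of linear maps. -/
def assembleMap (f : ∀ j, (F j).carrier →ₗ[R] (G j).carrier) :
    (assemble F i hi hfin).carrier →ₗ[R] (assemble G i hi hfin).carrier :=
  DFinsupp.mapRange.linearMap f

theorem assemble_isBicontrolled {b : ℝ} (f : ∀ j, (F j).carrier →ₗ[R] (G j).carrier)
    (h : ∀ j, IsBicontrolled (F j) (G j) (f j) b) :
    IsBicontrolled (assemble F i hi hfin) (assemble G i hi hfin)
      (assembleMap F G i hi hfin f) b := by
  refine ⟨fun S c hc => ?_, fun S y hy hyf => ?_⟩
  · rw [mem_assemble_fil] at hc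
    refine (mem_assemble_fil G i hi hfin).2 fun j => ?_
    exact (G j).fil_mono _ _ (enlarge_preimage_subset (hi j) S b) ((h j).1 _ _ (hc j))
  · obtain ⟨c₀, rfl⟩ := hyf
    rw [mem_assemble_fil] at hy
    obtain ⟨c, hc, hcy⟩ := exists_mapRange_eq f (fun j => (F j).fil (enlarge (i j ⁻¹' S) b))
      (assembleMap F G i hi hfin f c₀) fun j => (h j).2 _ _ (hy j) ⟨_, rfl⟩
    refine ⟨c, (mem_assemble_fil F i hi hfin).2 fun j => ?_, hcy⟩
    exact (F j).fil_mono _ _ (enlarge_preimage_subset (hi j) S b) (hc j)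

/-- Project to the summand. A ball of radius `δ` in `X` may have its centre outside the image of `Y
j`; recentring it at a point of `Y j` doubles the radius, and a ball missing the image contributes
zero. -/
theorem scatteredWith_of_assemble {δ : ℝ} (h : (assemble F i hi hfin).ScatteredWith δ) (j : ι) :
    (F j).ScatteredWith (2 * δ) := by
  rw [FilteredModule.scatteredWith_iff] at h ⊢
  rw [eq_top_iff]
  intro m _
  have h2 : (⨆ x, (assemble F i hi hfin).fil (enlarge {x} δ)) ≤
      (⨆ y, (F j).fil (enlarge {y} (2 * δ))).comap (assembleCoord F i hi hfin j) := by
    refine iSup_le fun x c hc => ?_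
    have hcj := (mem_assemble_fil F i hi hfin).1 hc j
    rcases (i j ⁻¹' enlarge {x} δ).eq_empty_or_nonempty with h0 | ⟨y, hy⟩
    · rw [h0, (F j).fil_empty] at hcj
      rw [Submodule.mem_comap, (Submodule.mem_bot R).1 hcj]
      exact zero_mem _
    · refine Submodule.mem_iSup_of_mem y ((F j).fil_mono _ _ (fun z hz => ?_) hcj)
      rw [Set.mem_preimage, mem_enlarge_singleton] at hy hz
      rw [mem_enlarge_singleton, ← (hi j).dist_eq]
      linarith [dist_triangle_right (i j z) (i j y) x]
  have h3 : assembleSingle F i hi hfin j m ∈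
      ⨆ x, (assemble F i hi hfin).fil (enlarge {x} δ) := h ▸ Submodule.mem_top
  simpa only [Submodule.mem_comap, assembleCoord_single] using h2 h3

/-- The direct sum of exact sequences of filtered modules. -/
def assembleSeq (𝓔 : ∀ j, ShortExactSeq.{u, t, w} R (Y j)) : ShortExactSeq.{u, v, w} R X where
  E' := assemble (fun j => (𝓔 j).E') i hi hfin
  E := assemble (fun j => (𝓔 j).E) i hi hfin
  E'' := assemble (fun j => (𝓔 j).E'') i hi hfin
  f := assembleMap _ _ i hi hfin fun j => (𝓔 j).f
  g := assembleMap _ _ i hi hfin fun j => (𝓔 j).g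
  injective := (DFinsupp.mapRange_injective _ fun j => map_zero (𝓔 j).f).2
    fun j => (𝓔 j).injective
  exact := by
    intro y
    constructor
    · intro hy
      obtain ⟨c, -, hc⟩ := exists_mapRange_eq (fun j => (𝓔 j).f) (fun j => ⊤) y fun j => by
        obtain ⟨m, hm⟩ := ((𝓔 j).exact _).1 (congrArg (assembleCoord _ i hi hfin j) hy)
        exact ⟨m, trivial, hm⟩
      exact ⟨c, hc⟩
    · rintro ⟨c, rfl⟩
      refine DFinsupp.ext fun j => ?_
      exact ((𝓔 j).exact _).2 ⟨_, rfl⟩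
  surjective := (DFinsupp.mapRange_surjective _ fun j => map_zero (𝓔 j).g).2
    fun j => (𝓔 j).surjective

end Assembly
-- Covering a lean module by a 0-lean, 0-insular one.
section Cover

variable {R : Type u} [Ring R] {X : Type v} [MetricSpace X]

/-- A finitely generated module, regarded as a filtered module over a point. -/
def pointModule {M : Type w} [AddCommGroup M] [Module R M] (N : Submodule R M) (hN : N.FG) :
    FilteredModule.{u, 0, w} R PUnit.{1} where
  carrier := N
  fil S := ⨆ _ : S.Nonempty, ⊤
  fil_mono S T h := iSup_le fun hS => le_iSup_of_le (hS.mono h) le_rfl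
  fil_univ := by simp
  fil_empty := by simp
  fil_fg S _ := by
    by_cases h : S.Nonempty
    · simpa [h] using (Submodule.fg_top N).2 hN
    · simpa [h] using Submodule.fg_bot

theorem pointModule_mem {M : Type w} [AddCommGroup M] [Module R M] {N : Submodule R M}
    (hN : N.FG) {S : Set PUnit.{1}} (hS : S.Nonempty) (m : N) :
    m ∈ (pointModule N hN).fil S :=
  Submodule.mem_iSup_of_mem hS trivial

theorem pointModule_leanWith {M : Type w} [AddCommGroup M] [Module R M] (N : Submodule R M)
    (hN : N.FG) : (pointModule N hN).LeanWith 0 := by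
  rw [FilteredModule.leanWith_iff]
  rintro S m hm
  by_cases h : S.Nonempty
  · obtain ⟨x, hx⟩ := h
    refine Submodule.mem_iSup_of_mem x (Submodule.mem_iSup_of_mem hx ?_)
    exact pointModule_mem hN ⟨x, subset_enlarge _ le_rfl rfl⟩ m
  · rw [Set.not_nonempty_iff_eq_empty.1 h, FilteredModule.fil_empty, Submodule.mem_bot] at hm
    rw [hm]
    exact zero_mem _

theorem pointModule_insularWith {M : Type w} [AddCommGroup M] [Module R M] (N : Submodule R M)
    (hN : N.FG) : (pointModule N hN).InsularWith 0 := by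
  intro S T m hS hT
  by_cases h : S.Nonempty ∧ T.Nonempty
  · obtain ⟨⟨x, hx⟩, ⟨y, hy⟩⟩ := h
    have hne : (enlarge S 0 ∩ enlarge T 0).Nonempty :=
      ⟨x, subset_enlarge _ le_rfl hx, subset_enlarge _ le_rfl hy⟩
    exact pointModule_mem hN hne m
  · have h0 : m = 0 := by
      rw [not_and_or, Set.not_nonempty_iff_eq_empty, Set.not_nonempty_iff_eq_empty] at h
      rcases h with h | h
      · rwa [h, FilteredModule.fil_empty, Submodule.mem_bot] at hS
      · rwa [h, FilteredModule.fil_empty, Submodule.mem_bot] at hT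
    rw [h0]
    exact zero_mem _

variable [Small.{w} X]

theorem finite_nonempty_preimage (hX : ∀ S : Set X, Bornology.IsBounded S → S.Finite) (S : Set X)
    (hS : Bornology.IsBounded S) : {j : Shrink.{w} X |
      ((fun _ : PUnit.{1} => (equivShrink X).symm j) ⁻¹' S).Nonempty}.Finite := by
  refine ((hX S hS).preimage ((equivShrink X).symm.injective.injOn)).subset ?_
  rintro j ⟨_, hj⟩
  exact hj

/-- The direct sum of the modules `F(x[D])`, each placed at the point `x`. -/
noncomputable abbrev cover (F : FilteredModule.{u, v, w} R X) (D : ℝ)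
    (hX : ∀ S : Set X, Bornology.IsBounded S → S.Finite) : FilteredModule.{u, v, w} R X :=
  assemble (fun j : Shrink.{w} X => pointModule (F.fil (enlarge {(equivShrink X).symm j} D))
      (F.fil_fg _ (Metric.isBounded_closedBall.subset
        fun _ hy => Metric.mem_closedBall.2 (mem_enlarge_singleton.1 hy))))
    (fun j _ => (equivShrink X).symm j) (fun _ => isometry_subsingleton)
    (finite_nonempty_preimage hX)

variable (F : FilteredModule.{u, v, w} R X) (D : ℝ)
  (hX : ∀ S : Set X, Bornology.IsBounded S → S.Finite)

theorem cover_leanWith : (cover F D hX).LeanWith 0 :=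
  assemble_leanWith _ _ _ _ fun _ => pointModule_leanWith _ _

theorem cover_insularWith : (cover F D hX).InsularWith 0 :=
  assemble_insularWith _ _ _ _ fun _ => pointModule_insularWith _ _

open Classical in
/-- The summation map from `cover F D` to `F`. -/
noncomputable def coverMap : (cover F D hX).carrier →ₗ[R] F.carrier :=
  DFinsupp.lsum ℕ (M := fun j : Shrink.{w} X => F.fil (enlarge {(equivShrink X).symm j} D))
    fun j => (F.fil (enlarge {(equivShrink X).symm j} D)).subtype

theorem coverMap_single (j : Shrink.{w} X) (m : F.fil (enlarge {(equivShrink X).symm j} D)) :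
    coverMap F D hX (assembleSingle _ _ _ _ j m) = m := by
  classical
  exact DFinsupp.lsum_single (R := R) ℕ
    (M := fun j : Shrink.{w} X => F.fil (enlarge {(equivShrink X).symm j} D))
    (fun j => (F.fil (enlarge {(equivShrink X).symm j} D)).subtype) j m

/-- Summands at points outside `S` vanish, and a summand at `x ∈ S` lies in `F(x[D])`. -/
theorem coverMap_mem {S : Set X} {c : (cover F D hX).carrier} (hc : c ∈ (cover F D hX).fil S) :
    coverMap F D hX c ∈ F.fil (enlarge S D) := by
  obtain ⟨s, hs⟩ := exists_eq_sum_assembleSingle _ _ _ _ c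
  have hc := (mem_assemble_fil _ _ _ _).1 hc
  rw [hs, map_sum]
  refine Submodule.sum_mem _ fun j _ => ?_
  refine (congrArg (· ∈ F.fil (enlarge S D)) (coverMap_single F D hX j _)).mpr ?_
  by_cases h : (equivShrink X).symm j ∈ S
  · exact F.fil_mono _ _ (enlarge_mono (Set.singleton_subset_iff.2 h) le_rfl) (Subtype.property _)
  · have := hc j
    rw [show (fun _ : PUnit.{1} => (equivShrink X).symm j) ⁻¹' S = ∅ from
      Set.eq_empty_of_forall_notMem fun _ => h, FilteredModule.fil_empty, Submodule.mem_bot] at this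
    rw [this]
    exact zero_mem (F.fil (enlarge S D))

/-- Leanness is just what makes the cover surjective on each `F(S)`, with no loss of control in
lifting. -/
theorem exists_coverMap_eq {F : FilteredModule.{u, v, w} R X} {D : ℝ} (hF : F.LeanWith D)
    {S : Set X} {m : F.carrier} (hm : m ∈ F.fil S) :
    ∃ c ∈ (cover F D hX).fil S, coverMap F D hX c = m := by
  rw [FilteredModule.leanWith_iff] at hF
  suffices h : (⨆ x ∈ S, F.fil (enlarge {x} D)) ≤
      ((cover F D hX).fil S).map (coverMap F D hX) from h (hF S hm)
  refine iSup₂_le fun x hx => ?_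
  obtain ⟨j, rfl⟩ := (equivShrink X).symm.surjective x
  intro n hn
  exact ⟨assembleSingle _ _ _ _ j ⟨n, hn⟩,
    assembleSingle_mem _ _ _ _ (pointModule_mem _ ⟨PUnit.unit, hx⟩ _), coverMap_single F D hX j _⟩

end Cover

/-! ### Removing insularity of the middle term; uniform constants. -/

section Sub

variable {R : Type u} [Ring R] {X : Type v} [MetricSpace X]

/-- This is where the Noetherian hypothesis acts: it keeps induced filtrations locally finitely
generated, both for the kernel in `coverSeq` and for the terms of `restrictSeq`. -/
theorem fg_comap_subtype [IsNoetherianRing R] {M : Type w} [AddCommGroup M] [Module R M]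
    (N P : Submodule R M) (hP : P.FG) : (P.comap N.subtype).FG := by
  refine Submodule.fg_of_fg_map_injective N.subtype N.injective_subtype ?_
  exact hP.of_le (Submodule.map_comap_le _ _)

/-- A submodule of a filtered module with the induced filtration. -/
def subFiltered [IsNoetherianRing R] (F : FilteredModule.{u, v, w} R X)
    (N : Submodule R F.carrier) : FilteredModule.{u, v, w} R X where
  carrier := N
  fil S := (F.fil S).comap N.subtype
  fil_mono S T h := Submodule.comap_mono (F.fil_mono S T h)
  fil_univ := by rw [F.fil_univ, Submodule.comap_top]
  fil_empty := by rw [F.fil_empty, Submodule.comap_bot, Submodule.ker_subtype]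
  fil_fg S hS := fg_comap_subtype _ _ (F.fil_fg S hS)

/-- The kernel of the composition of `coverMap` with the epimorphism of an exact sequence gives
a new exact sequence with the same quotient. -/
noncomputable def coverSeq [IsNoetherianRing R] [Small.{w} X] (𝓔 : ShortExactSeq.{u, v, w} R X)
    (D : ℝ) (hX : ∀ S : Set X, Bornology.IsBounded S → S.Finite) (hE : 𝓔.E.LeanWith D) :
    ShortExactSeq.{u, v, w} R X where
  E' := subFiltered (cover 𝓔.E D hX) (LinearMap.ker (𝓔.g ∘ₗ coverMap 𝓔.E D hX))
  E := cover 𝓔.E D hX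
  E'' := 𝓔.E''
  f := (LinearMap.ker (𝓔.g ∘ₗ coverMap 𝓔.E D hX)).subtype
  g := 𝓔.g ∘ₗ coverMap 𝓔.E D hX
  injective := Submodule.injective_subtype _
  exact := LinearMap.exact_subtype_ker_map _
  surjective := 𝓔.surjective.comp fun m => by
    obtain ⟨c, -, hc⟩ := exists_coverMap_eq hX hE (S := Set.univ) (m := m)
      (𝓔.E.fil_univ ▸ Submodule.mem_top)
    exact ⟨c, hc⟩

/-- In a weakly coarsely coherent space the middle term need not be insular. -/
theorem WeaklyCoarselyCoherent.exists_scatteredWith [IsNoetherianRing R] [Small.{w} X]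
    (hX : ∀ S : Set X, Bornology.IsBounded S → S.Finite)
    (h : WeaklyCoarselyCoherent.{u, v, w} R X) (𝓔 : ShortExactSeq.{u, v, w} R X) {D d b : ℝ}
    (hD : 0 ≤ D) (hd : 0 ≤ d) (hb : 0 ≤ b) (hE : 𝓔.E.LeanWith D) (hE'' : 𝓔.E''.InsularWith d)
    (hf : IsBicontrolled 𝓔.E' 𝓔.E 𝓔.f b) (hg : IsBicontrolled 𝓔.E 𝓔.E'' 𝓔.g b) :
    ∃ δ : ℝ, 0 ≤ δ ∧ 𝓔.E'.ScatteredWith δ := by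
  obtain ⟨δ, hδ, hs⟩ := h (coverSeq 𝓔 D hX hE)
    ⟨0, le_rfl, fun S m hm => FilteredModule.fil_mono _ _ _ (subset_enlarge _ le_rfl) hm,
      fun S y hy ⟨m, hm⟩ => ⟨m, by
        subst hm
        exact FilteredModule.fil_mono _ _ _ (subset_enlarge S le_rfl) hy, hm⟩⟩
    -- Summation costs `D` and `g` costs `b`; lifting back costs only `b`.
    ⟨D + b, by positivity, fun S m hm => 𝓔.E''.fil_mono _ _ (enlarge_enlarge_subset S D b)
        (hg.1 _ _ (coverMap_mem _ _ _ hm)), fun S y hy _ => by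
        obtain ⟨m, hm, rfl⟩ := hg.2 S y hy (𝓔.surjective y)
        obtain ⟨c, hc, rfl⟩ := exists_coverMap_eq hX hE hm
        exact ⟨c, FilteredModule.fil_mono _ _ _ (enlarge_mono le_rfl (by linarith)) hc, rfl⟩⟩
    ⟨0, le_rfl, cover_leanWith _ _ hX⟩ ⟨0, le_rfl, cover_insularWith _ _ hX⟩ ⟨d, hd, hE''⟩
  refine ⟨δ + D + b, by positivity, ?_⟩
  rw [FilteredModule.scatteredWith_iff] at hs ⊢
  rw [eq_top_iff]
  intro u _
  obtain ⟨c, -, hc⟩ := exists_coverMap_eq hX hE (S := Set.univ) (m := 𝓔.f u)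
    (𝓔.E.fil_univ ▸ Submodule.mem_top)
  have hcker : c ∈ LinearMap.ker (𝓔.g ∘ₗ coverMap 𝓔.E D hX) := by
    rw [LinearMap.mem_ker, LinearMap.comp_apply, hc]
    exact 𝓔.exact.apply_apply_eq_zero u
  -- A kernel element over `x[δ]` sums to an element of `ker g = im f` over `x[δ + D]`, which
  -- bicontrol of `f` lifts to `x[δ + D + b]`.
  have key : (⨆ x, (coverSeq 𝓔 D hX hE).E'.fil (enlarge {x} δ)) ≤
      ((⨆ x, 𝓔.E'.fil (enlarge {x} (δ + D + b))).map 𝓔.f).comap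
        (coverMap 𝓔.E D hX ∘ₗ (coverSeq 𝓔 D hX hE).f) := by
    refine iSup_le fun x k hk => ?_
    have h1 : coverMap 𝓔.E D hX k.1 ∈ 𝓔.E.fil (enlarge {x} (δ + D)) :=
      𝓔.E.fil_mono _ _ (enlarge_enlarge_subset _ _ _) (coverMap_mem 𝓔.E D hX hk)
    obtain ⟨m, hm, hmk⟩ := hf.2 _ _ h1 ((𝓔.exact _).1 k.2)
    exact ⟨m, Submodule.mem_iSup_of_mem x
      (𝓔.E'.fil_mono _ _ (enlarge_enlarge_subset _ _ _) hm), hmk⟩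
  obtain ⟨u', hu', he⟩ := key (x := (⟨c, hcker⟩ : LinearMap.ker (𝓔.g ∘ₗ coverMap 𝓔.E D hX)))
    (hs.ge trivial)
  have : u' = u := 𝓔.injective (he.trans hc)
  exact this ▸ hu'

/-- Uniformity of the scattering constant for families of spaces which embed isometrically into a
weakly coarsely coherent space and are locally finite there. -/
theorem WeaklyCoarselyCoherent.exists_uniform_scatteredWith [IsNoetherianRing R] [Small.{w} X]
    (hX : ∀ S : Set X, Bornology.IsBounded S → S.Finite)
    (h : WeaklyCoarselyCoherent.{u, v, w} R X) {ι : Type w} {Y : ι → Type t}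
    [∀ j, MetricSpace (Y j)] (i : ∀ j, Y j → X) (hi : ∀ j, Isometry (i j))
    (hfin : ∀ S : Set X, Bornology.IsBounded S → {j | (i j ⁻¹' S).Nonempty}.Finite)
    (𝓔 : ∀ j, ShortExactSeq.{u, t, w} R (Y j)) {D d b : ℝ}
    (hD : 0 ≤ D) (hd : 0 ≤ d) (hb : 0 ≤ b) (hE : ∀ j, (𝓔 j).E.LeanWith D)
    (hE'' : ∀ j, (𝓔 j).E''.InsularWith d)
    (hf : ∀ j, IsBicontrolled (𝓔 j).E' (𝓔 j).E (𝓔 j).f b)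
    (hg : ∀ j, IsBicontrolled (𝓔 j).E (𝓔 j).E'' (𝓔 j).g b) :
    ∃ δ : ℝ, 0 ≤ δ ∧ ∀ j, (𝓔 j).E'.ScatteredWith δ := by
  obtain ⟨δ, hδ, hs⟩ := h.exists_scatteredWith hX (assembleSeq i hi hfin 𝓔) hD hd hb
    (assemble_leanWith _ i hi hfin hE) (assemble_insularWith _ i hi hfin hE'')
    (assemble_isBicontrolled _ _ i hi hfin _ hf) (assemble_isBicontrolled _ _ i hi hfin _ hg)
  exact ⟨2 * δ, by positivity, fun j => scatteredWith_of_assemble _ i hi hfin hs j⟩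

end Sub
-- Finitely generated subgroups and their cosets.
section Groups

variable {Γ : Type v} [Group Γ]

open Pointwise in
/-- A subgroup `K` with `Γ = B * K` is generated by its elements in a finite set depending only on
`B` and on generators of `Γ`. -/
theorem closure_inter_eq_of_forall_exists_mul_mem {B T : Set Γ} (hT : Subgroup.closure T = ⊤)
    {K : Subgroup Γ} (hK : ∀ a, ∃ h ∈ K, a * h ∈ B) :
    Subgroup.closure ((K : Set Γ) ∩ (B ∪ B⁻¹ * (T ∪ T⁻¹) * B)) = K := by
  set W : Set Γ := B ∪ B⁻¹ * (T ∪ T⁻¹) * B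
  set K' := Subgroup.closure ((K : Set Γ) ∩ W)
  have hK' : K' ≤ K := (Subgroup.closure_le _).2 Set.inter_subset_left
  refine le_antisymm hK' ?_
  have hB : ∀ x ∈ K, x ∈ B → x ∈ K' := fun x hx hxB =>
    Subgroup.subset_closure ⟨hx, Or.inl hxB⟩
  -- Schreier's argument: the elements that `K'` can move into `B` are stable under left
  -- multiplication by generators, since the correction `h` has inverse `(tgkh)⁻¹ t (gk)` in `B⁻¹ (T
  -- ∪ T⁻¹) B`.
  have step : ∀ t ∈ T ∪ T⁻¹, ∀ g, (∃ k ∈ K', g * k ∈ B) → ∃ k ∈ K', t * g * k ∈ B := by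
    rintro t ht g ⟨k, hk, hgk⟩
    obtain ⟨h, hh, hb⟩ := hK (t * (g * k))
    have : h⁻¹ ∈ K' := by
      refine Subgroup.subset_closure ⟨K.inv_mem hh, Or.inr ?_⟩
      refine ⟨(t * (g * k) * h)⁻¹ * t, ⟨_, Set.inv_mem_inv.2 hb, t, ht, rfl⟩, g * k, hgk, ?_⟩
      simp [mul_assoc]
    exact ⟨k * h, K'.mul_mem hk (by simpa using K'.inv_mem this), by simpa [mul_assoc] using hb⟩
  have all : ∀ g : Γ, ∃ k ∈ K', g * k ∈ B := by
    intro g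
    have hg : g ∈ Subgroup.closure T := hT ▸ Subgroup.mem_top g
    induction hg using Subgroup.closure_induction_left with
    | one =>
      obtain ⟨h, hh, hb⟩ := hK 1
      exact ⟨h, hB h hh (by simpa using hb), hb⟩
    | mul_left x hx y _ ih => exact step x (Or.inl hx) y ih
    | inv_mul_cancel x hx y _ ih => exact step x⁻¹ (Or.inr (Set.inv_mem_inv.2 hx)) y ih
  intro h hh
  obtain ⟨k, hk, hb⟩ := all h
  have := K'.mul_mem (hB _ (K.mul_mem hh (hK' hk)) hb) (K'.inv_mem hk)
  simpa using this

/-- Only finitely many finitely generated subgroups have a given finite set meeting all of their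
cosets. -/
theorem finite_setOf_forall_exists_mul_mem {B : Set Γ} (hB : B.Finite) :
    {K : {H : Subgroup Γ // H.FG} | ∀ a, ∃ h ∈ K.1, a * h ∈ B}.Finite := by
  open Pointwise in
  rcases Set.eq_empty_or_nonempty {K : {H : Subgroup Γ // H.FG} | ∀ a, ∃ h ∈ K.1, a * h ∈ B}
    with h0 | ⟨⟨K₀, T₀, hT₀⟩, hK₀⟩
  · rw [h0]
    exact Set.finite_empty
  · have hT : Subgroup.closure (B ∪ T₀) = ⊤ := by
      rw [eq_top_iff]
      intro g _
      obtain ⟨h, hh, hb⟩ := hK₀ g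
      have h1 : h ∈ Subgroup.closure (B ∪ T₀) :=
        Subgroup.closure_mono Set.subset_union_right (hT₀ ▸ hh)
      have h2 : g * h ∈ Subgroup.closure (B ∪ T₀) := Subgroup.subset_closure (Or.inl hb)
      simpa using mul_mem h2 (inv_mem h1)
    have hTf : (B ∪ T₀).Finite := hB.union T₀.finite_toSet
    have hW : (B ∪ B⁻¹ * ((B ∪ T₀) ∪ (B ∪ T₀)⁻¹) * B).Finite :=
      hB.union ((hB.inv.mul (hTf.union hTf.inv)).mul hB)
    refine Set.Finite.of_finite_image 
      (f := fun K => (K.1 : Set Γ) ∩ (B ∪ B⁻¹ * ((B ∪ T₀) ∪ (B ∪ T₀)⁻¹) * B))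
      (hW.finite_subsets.subset ?_) fun K hK L hL hKL => ?_
    · rintro _ ⟨K, -, rfl⟩
      exact Set.inter_subset_right
    · apply Subtype.ext
      rw [← closure_inter_eq_of_forall_exists_mul_mem hT hK,
        ← closure_inter_eq_of_forall_exists_mul_mem hT hL]
      exact congrArg Subgroup.closure hKL

theorem countable_fg_subgroups [Countable Γ] : Countable {H : Subgroup Γ // H.FG} := by
  choose T hT using fun K : {H : Subgroup Γ // H.FG} => K.2
  refine Function.Injective.countable (f := T) fun K L h => Subtype.ext ?_
  rw [← hT K, ← hT L, h]

/-- The finitely generated subgroups can be translated so that every member of a given increasing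
sequence of finite sets meets only finitely many of the translates. -/
theorem exists_translates [Countable Γ] {B : ℕ → Set Γ} (hB : ∀ n, (B n).Finite)
    (hmono : Monotone B) : ∃ a : {H : Subgroup Γ // H.FG} → Γ,
      ∀ n, {K | ∃ h ∈ K.1, a K * h ∈ B n}.Finite := by
  classical
  have := countable_fg_subgroups (Γ := Γ)
  obtain ⟨e, he⟩ := exists_injective_nat {H : Subgroup Γ // H.FG}
  let P (K : {H : Subgroup Γ // H.FG}) (n : ℕ) : Prop := ∃ a, ∀ h ∈ K.1, a * h ∉ B n
  have hP : ∀ K, ∃ a, ∀ n ≤ e K, P K n → ∀ h ∈ K.1, a * h ∉ B n := by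
    intro K
    by_cases hK : ∃ n ≤ e K, P K n
    · obtain ⟨n, hn, hPn⟩ := hK
      -- The translate avoids the largest avoidable `B n` with `n ≤ e K`, hence all smaller ones. So
      -- `B n` is met only if `e K < n` or every coset of `K` meets `B n`.
      obtain ⟨a, ha⟩ := Nat.findGreatest_spec hn hPn
      exact ⟨a, fun m hm hPm h hh hmem => ha h hh (hmono (Nat.le_findGreatest hm hPm) hmem)⟩
    · exact ⟨1, fun n hn hPn => (hK ⟨n, hn, hPn⟩).elim⟩
  choose a ha using hP
  refine ⟨a, fun n => ?_⟩
  refine ((finite_setOf_forall_exists_mul_mem (hB n)).union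
    ((Set.finite_lt_nat n).preimage he.injOn)).subset ?_
  rintro K ⟨h, hh, hmem⟩
  by_contra hcon
  simp only [Set.mem_union, Set.mem_ofPred_eq, Set.mem_preimage, not_or, not_lt] at hcon
  obtain ⟨h1, h2⟩ := hcon
  push Not at h1
  exact ha K n h2 h1 h hh hmem

/-- Every finite subset is contained in a finitely generated subgroup `H` all of whose cosets can
be distributed over the finitely generated subgroups containing `H`. -/
theorem exists_subgroup_and_representatives [Countable Γ] {B : Set Γ} (hB : B.Finite) :
    ∃ H : Subgroup Γ, B ⊆ H ∧ ∃ a : {H : Subgroup Γ // H.FG} → Γ,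
      ∀ g, ∃ K, H ≤ K.1 ∧ (a K)⁻¹ * g ∈ H := by
  by_cases hΓ : (⊤ : Subgroup Γ).FG
  · exact ⟨⊤, fun _ _ => trivial, fun _ => 1, fun g => ⟨⟨⊤, hΓ⟩, le_rfl, trivial⟩⟩
  · let H := Subgroup.closure B
    have hH : H.FG := (Subgroup.fg_iff _).2 ⟨B, rfl, hB⟩
    refine ⟨H, Subgroup.subset_closure, ?_⟩
    -- Were there finitely many, their supremum would be finitely generated; but it contains every
    -- `g`, as `H ⊔ ⟨g⟩` is one of them.
    have : Infinite {K : {H : Subgroup Γ // H.FG} // H ≤ K.1} := by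
      by_contra hcon
      rw [not_infinite_iff_finite] at hcon
      apply hΓ
      have : (⨆ K : {K : {H : Subgroup Γ // H.FG} // H ≤ K.1}, K.1.1) = ⊤ := by
        rw [eq_top_iff]
        intro g _
        have hg : (H ⊔ Subgroup.zpowers g).FG :=
          hH.sup ((Subgroup.fg_iff _).2 ⟨{g}, (Subgroup.zpowers_eq_closure g).symm,
            Set.finite_singleton g⟩)
        exact Subgroup.mem_iSup_of_mem (ι := {K : {H : Subgroup Γ // H.FG} // H ≤ K.1})
          ⟨⟨_, hg⟩, le_sup_left⟩
          (le_sup_right (a := H) (Subgroup.mem_zpowers g))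
      rw [← this]
      exact Subgroup.FG.iSup _ fun K => K.1.2
    obtain ⟨e, he⟩ := exists_injective_nat Γ
    let φ : Γ → {K : {H : Subgroup Γ // H.FG} // H ≤ K.1} := fun g => Infinite.natEmbedding _ (e g)
    have hφ : Function.Injective fun g => (φ g).1 :=
      Subtype.val_injective.comp ((Infinite.natEmbedding _).injective.comp he)
    refine ⟨Function.invFun fun g => (φ g).1, fun g => ⟨(φ g).1, (φ g).2, ?_⟩⟩
    rw [Function.leftInverse_invFun hφ g, inv_mul_cancel]
    exact H.one_mem

end Groups
-- Restriction to separated pieces.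
section Restriction

variable {R : Type u} [Ring R] {X : Type v} [MetricSpace X]

/-- Since `C` is closed under `r`-enlargement, cutting down to `C` does not spoil enlargements; all
constants up to `r` therefore survive restriction unchanged. -/
theorem enlarge_image_inter_subset {Y : Type t} [MetricSpace Y] {i : Y → X} (hi : Isometry i)
    {C : Set X} (hC : C ⊆ Set.range i) {r : ℝ} (hCr : enlarge C r ⊆ C) (S : Set Y) :
    enlarge (i '' S ∩ C) r ⊆ i '' enlarge S r ∩ C := by
  rintro x ⟨_, ⟨⟨s, hs, rfl⟩, hsC⟩, hx⟩
  have hxC : x ∈ C := hCr ⟨_, hsC, hx⟩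
  obtain ⟨y, rfl⟩ := hC hxC
  exact ⟨⟨y, ⟨s, hs, by rwa [← hi.dist_eq]⟩, rfl⟩, hxC⟩

theorem comap_le_fil_of_isBicontrolled {C : Set X} {r : ℝ} {F G : FilteredModule.{u, v, w} R X}
    {f : F.carrier →ₗ[R] G.carrier} (hf : Function.Injective f) (h : IsBicontrolled F G f r)
    (hCr : enlarge C r ⊆ C) : (G.fil C).comap f ≤ F.fil C := by
  intro m hm
  obtain ⟨m', hm', he⟩ := h.2 C (f m) hm ⟨m, rfl⟩
  rw [← hf he]
  exact F.fil_mono _ _ hCr hm'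

theorem map_fil_le_of_isBicontrolled {C : Set X} {r : ℝ} {F G : FilteredModule.{u, v, w} R X}
    {f : F.carrier →ₗ[R] G.carrier} (h : IsBicontrolled F G f r)
    (hCr : enlarge C r ⊆ C) : (F.fil C).map f ≤ G.fil C := by
  rintro _ ⟨m, hm, rfl⟩
  exact G.fil_mono _ _ hCr (h.1 C m hm)

/-- If `X` is partitioned into well separated pieces, then the kernel of an exact sequence is
generated by the parts which lie over the pieces. -/
theorem eq_top_of_forall_comap_le (𝓔 : ShortExactSeq.{u, v, w} R X) {r : ℝ} {Q : Type t} (q : X → Q)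
    (hq : ∀ x y, dist x y ≤ r → q x = q y) (hE : 𝓔.E.LeanWith r) (hE'' : 𝓔.E''.InsularWith r)
    (hg : IsBicontrolled 𝓔.E 𝓔.E'' 𝓔.g r) (T : Submodule R 𝓔.E'.carrier)
    (hT : ∀ a, (𝓔.E.fil (q ⁻¹' {a})).comap 𝓔.f ≤ T) : T = ⊤ := by
  classical
  have hq' : ∀ A : Set Q, enlarge (q ⁻¹' A) r ⊆ q ⁻¹' A := by
    rintro A x ⟨y, hy, hxy⟩
    rw [Set.mem_preimage, hq x y hxy]
    exact hy
  rw [eq_top_iff]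
  intro u _
  have hu : 𝓔.f u ∈ 𝓔.E.fil Set.univ := 𝓔.E.fil_univ ▸ Submodule.mem_top
  obtain ⟨c, -, hc, hsum⟩ := hE _ _ hu
  have hmem : ∀ (A : Set Q) (s : Finset X), (∀ x ∈ s, q x ∈ A) →
      ∑ x ∈ s, c x ∈ 𝓔.E.fil (q ⁻¹' A) := by
    intro A s hs
    refine Submodule.sum_mem _ fun x hx => ?_
    refine 𝓔.E.fil_mono _ _ ((enlarge_mono ?_ le_rfl).trans (hq' A)) (hc x)
    exact Set.singleton_subset_iff.2 (hs x hx)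
  have hpart : ∀ a, ∃ m ∈ T, 𝓔.f m = ∑ x ∈ c.support with q x = a, c x := by
    intro a
    have h1 := hmem {a} {x ∈ c.support | q x = a} fun x hx => (Finset.mem_filter.1 hx).2
    have h2 := hmem {a}ᶜ {x ∈ c.support | ¬ q x = a} fun x hx => (Finset.mem_filter.1 hx).2
    have hadd : (∑ x ∈ c.support with q x = a, c x) + ∑ x ∈ c.support with ¬ q x = a, c x =
        𝓔.f u := by
      rw [Finset.sum_filter_add_sum_filter_not, hsum]
      rfl
    have hg0 : 𝓔.g (∑ x ∈ c.support with q x = a, c x) =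
        -𝓔.g (∑ x ∈ c.support with ¬ q x = a, c x) := by
      rw [eq_neg_iff_add_eq_zero, ← map_add, hadd]
      exact 𝓔.exact.apply_apply_eq_zero u
    have h3 := 𝓔.E''.fil_mono _ _ (hq' _) (hg.1 _ _ h1)
    have h4 := 𝓔.E''.fil_mono _ _ (hq' _) (hg.1 _ _ h2)
    -- The image of the part over `a` is also minus the image of the rest, so it lies over the piece
    -- and over its complement. Their `r`-enlargements are disjoint, so insularity makes it zero.
    have h5 := hE'' _ _ _ h3 (hg0 ▸ neg_mem h4)
    have h6 := 𝓔.E''.fil_mono _ ∅ (fun x hx => hq' {a}ᶜ hx.2 (hq' {a} hx.1)) h5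
    rw [𝓔.E''.fil_empty, Submodule.mem_bot] at h6
    obtain ⟨m, hm⟩ := (𝓔.exact _).1 h6
    exact ⟨m, hT a (by rw [Submodule.mem_comap, hm]; exact h1), hm⟩
  choose m hmT hm using hpart
  have : u = ∑ a ∈ c.support.image q, m a := by
    apply 𝓔.injective
    rw [map_sum, Finset.sum_congr rfl fun a _ => hm a, hsum]
    exact (Finset.sum_fiberwise_of_maps_to (fun x hx => Finset.mem_image_of_mem q hx) c).symm
  rw [this]
  exact Submodule.sum_mem _ fun a _ => hmT a

variable [IsNoetherianRing R]

/-- A submodule of a filtered module which is supported on the subset `C` of `X`, as a filtered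
module over a space which maps isometrically onto a subset containing `C`. -/
def restrict (F : FilteredModule.{u, v, w} R X) (N : Submodule R F.carrier) {Y : Type t}
    [MetricSpace Y] (i : Y → X) (hi : Isometry i) (C : Set X) (hC : C ⊆ Set.range i)
    (hN : N ≤ F.fil C) : FilteredModule.{u, t, w} R Y where
  carrier := N
  fil S := (F.fil (i '' S ∩ C)).comap N.subtype
  fil_mono S T h := Submodule.comap_mono
    (F.fil_mono _ _ (Set.inter_subset_inter_left C (Set.image_mono h)))
  fil_univ := by
    rwa [Set.image_univ, Set.inter_eq_right.2 hC, Submodule.comap_subtype_eq_top]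
  fil_empty := by
    rw [Set.image_empty, Set.empty_inter, F.fil_empty, Submodule.comap_bot, Submodule.ker_subtype]
  fil_fg S hS := fg_comap_subtype _ _
    (F.fil_fg _ ((hi.lipschitz.isBounded_image hS).subset Set.inter_subset_left))

variable {Y : Type t} [MetricSpace Y] {i : Y → X} (hi : Isometry i) {C : Set X}
  (hC : C ⊆ Set.range i) {r : ℝ}

theorem restrict_leanWith (hCr : enlarge C r ⊆ C) (F : FilteredModule.{u, v, w} R X)
    (h : F.LeanWith r) :
    (restrict F (F.fil C) i hi C hC le_rfl).LeanWith r := by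
  rw [FilteredModule.leanWith_iff] at h ⊢
  rintro S ⟨m, hmC⟩ hm
  let j : (restrict F (F.fil C) i hi C hC le_rfl).carrier →ₗ[R] F.carrier := (F.fil C).subtype
  have key : (⨆ x ∈ i '' S ∩ C, F.fil (enlarge {x} r)) ≤
      (⨆ y ∈ S, (restrict F (F.fil C) i hi C hC le_rfl).fil (enlarge {y} r)).map j := by
    refine iSup₂_le ?_
    rintro _ ⟨⟨y, hy, rfl⟩, hyC⟩ n hn
    have hsub := enlarge_image_inter_subset hi hC hCr {y}
    rw [Set.image_singleton, Set.inter_eq_left.2 (Set.singleton_subset_iff.2 hyC)] at hsub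
    have hn' := F.fil_mono _ _ hsub hn
    exact ⟨⟨n, F.fil_mono _ _ Set.inter_subset_right hn'⟩,
      Submodule.mem_iSup_of_mem y (Submodule.mem_iSup_of_mem hy hn'), rfl⟩
  obtain ⟨m', hm', rfl⟩ := key (h _ hm)
  exact hm'

theorem restrict_insularWith (hCr : enlarge C r ⊆ C) (F : FilteredModule.{u, v, w} R X)
    (N : Submodule R F.carrier) (hN : N ≤ F.fil C) (h : F.InsularWith r) :
    (restrict F N i hi C hC hN).InsularWith r := by
  intro S T m hS hT
  refine F.fil_mono _ _ ?_ (h _ _ _ hS hT)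
  rintro x ⟨hxS, hxT⟩
  obtain ⟨⟨y, hy, rfl⟩, hyC⟩ := enlarge_image_inter_subset hi hC hCr S hxS
  obtain ⟨⟨y', hy', h'⟩, -⟩ := enlarge_image_inter_subset hi hC hCr T hxT
  exact ⟨⟨y, ⟨hy, hi.injective h' ▸ hy'⟩, rfl⟩, hyC⟩

/-- The condition `hlift` keeps controlled lifts inside `N`. It is immediate in both uses: `N` is
the full preimage of `P` for `f`, and all of `F(C)` for `g`. -/
theorem restrict_isBicontrolled (hCr : enlarge C r ⊆ C) {F G : FilteredModule.{u, v, w} R X}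
    {N : Submodule R F.carrier} {P : Submodule R G.carrier} (hN : N ≤ F.fil C) (hP : P ≤ G.fil C)
    {f : F.carrier →ₗ[R] G.carrier} (hfN : ∀ n ∈ N, f n ∈ P)
    (hlift : ∀ m ∈ F.fil C, f m ∈ P → m ∈ N) (h : IsBicontrolled F G f r) :
    IsBicontrolled (restrict F N i hi C hC hN) (restrict G P i hi C hC hP) (f.restrict hfN) r := by
  refine ⟨fun S m hm => G.fil_mono _ _ (enlarge_image_inter_subset hi hC hCr S) (h.1 _ _ hm), ?_⟩
  rintro S y hy ⟨n, hn⟩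
  obtain ⟨m, hm, hmy⟩ := h.2 _ y.1 hy ⟨n.1, congrArg Subtype.val hn⟩
  have hm' := F.fil_mono _ _ (enlarge_image_inter_subset hi hC hCr S) hm
  exact ⟨⟨m, hlift m (F.fil_mono _ _ Set.inter_subset_right hm') (hmy ▸ y.2)⟩, hm',
    Subtype.ext hmy⟩

theorem le_iSup_of_restrict_scatteredWith {F : FilteredModule.{u, v, w} R X}
    {N : Submodule R F.carrier} {hN : N ≤ F.fil C} {δ : ℝ}
    (h : (restrict F N i hi C hC hN).ScatteredWith δ) : N ≤ ⨆ x, F.fil (enlarge {x} δ) := by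
  rw [FilteredModule.scatteredWith_iff] at h
  have key : (⨆ y, (restrict F N i hi C hC hN).fil (enlarge {y} δ)) ≤
      (⨆ x, F.fil (enlarge {x} δ)).comap N.subtype := by
    refine iSup_le fun y n hn => ?_
    refine Submodule.mem_iSup_of_mem (i y) (F.fil_mono _ _ ?_ hn)
    rintro _ ⟨⟨z, hz, rfl⟩, -⟩
    rw [mem_enlarge_singleton] at hz ⊢
    rwa [hi.dist_eq]
  intro m hm
  exact key (x := (⟨m, hm⟩ : N)) (h.ge trivial)

/-- The restriction of an exact sequence to a subset `C` which is separated from its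
complement. -/
def restrictSeq (𝓔 : ShortExactSeq.{u, v, w} R X) (i : Y → X) (hi : Isometry i) (C : Set X)
    (hC : C ⊆ Set.range i) (h' : (𝓔.E.fil C).comap 𝓔.f ≤ 𝓔.E'.fil C)
    (h'' : (𝓔.E.fil C).map 𝓔.g ≤ 𝓔.E''.fil C) : ShortExactSeq.{u, t, w} R Y where
  E' := restrict 𝓔.E' ((𝓔.E.fil C).comap 𝓔.f) i hi C hC h'
  E := restrict 𝓔.E (𝓔.E.fil C) i hi C hC le_rfl
  E'' := restrict 𝓔.E'' ((𝓔.E.fil C).map 𝓔.g) i hi C hC h''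
  f := 𝓔.f.restrict fun _ hn => hn
  g := 𝓔.g.restrict fun _ hn => Submodule.mem_map_of_mem hn
  injective _ _ h := Subtype.ext (𝓔.injective (congrArg Subtype.val h))
  exact y := by
    constructor
    · intro hy
      obtain ⟨m, hm⟩ := (𝓔.exact y.1).1 (congrArg Subtype.val hy)
      exact ⟨⟨m, (hm ▸ y.2 : 𝓔.f m ∈ 𝓔.E.fil C)⟩, Subtype.ext hm⟩
    · rintro ⟨m, rfl⟩
      exact Subtype.ext (𝓔.exact.apply_apply_eq_zero m.1)
  surjective := by
    rintro ⟨_, m, hm, rfl⟩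
    exact ⟨⟨m, hm⟩, rfl⟩

end Restriction
-- The two implications.
section Main

variable {R : Type u} [Ring R]

theorem FilteredModule.LeanWith.mono {X : Type v} [MetricSpace X]
    {F : FilteredModule.{u, v, w} R X} {D D' : ℝ} (h : F.LeanWith D) (hD : D ≤ D') :
    F.LeanWith D' := fun S m hm =>
  let ⟨c, hS, hc, he⟩ := h S m hm
  ⟨c, hS, fun x => F.fil_mono _ _ (enlarge_mono le_rfl hD) (hc x), he⟩

theorem FilteredModule.InsularWith.mono {X : Type v} [MetricSpace X]
    {F : FilteredModule.{u, v, w} R X} {d d' : ℝ} (h : F.InsularWith d) (hd : d ≤ d') :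
    F.InsularWith d' := fun S T m hS hT =>
  F.fil_mono _ _ (Set.inter_subset_inter (enlarge_mono le_rfl hd) (enlarge_mono le_rfl hd))
    (h S T m hS hT)

theorem IsBicontrolled.mono {X : Type v} [MetricSpace X] {F G : FilteredModule.{u, v, w} R X}
    {f : F.carrier →ₗ[R] G.carrier} {b b' : ℝ} (h : IsBicontrolled F G f b) (hb : b ≤ b') :
    IsBicontrolled F G f b' :=
  ⟨fun S m hm => G.fil_mono _ _ (enlarge_mono le_rfl hb) (h.1 S m hm), fun S y hy hyf =>
    let ⟨m, hm, he⟩ := h.2 S y hy hyf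
    ⟨m, F.fil_mono _ _ (enlarge_mono le_rfl hb) hm, he⟩⟩

variable {Γ : Type v} [Group Γ] [MetricSpace Γ]

theorem isometry_mul_subgroup (hΓ : ∀ g x y : Γ, dist (g * x) (g * y) = dist x y)
    (K : Subgroup Γ) (a : Γ) : Isometry fun h : K => a * (h : Γ) :=
  Isometry.of_dist_eq fun x y => hΓ a x y

theorem coarselyCoherentFamily_of_weaklyCoarselyCoherent [IsNoetherianRing R] [Countable Γ]
    (hΓ : ∀ g x y : Γ, dist (g * x) (g * y) = dist x y)
    (hfin : ∀ S : Set Γ, Bornology.IsBounded S → S.Finite)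
    (h : WeaklyCoarselyCoherent.{u, v, w} R Γ) : CoarselyCoherentFamily.{u, v, w, v} R
      (fun H : {H : Subgroup Γ // H.FG} => (H.1 : Type v)) := by
  intro 𝓔 D d b hD hd hb hE hE'' hf hg
  have := countable_fg_subgroups (Γ := Γ)
  obtain ⟨a, ha⟩ := exists_translates
    (fun n : ℕ => hfin (Metric.closedBall 1 n) Metric.isBounded_closedBall)
    fun m n hmn => Metric.closedBall_subset_closedBall (Nat.cast_le.2 hmn)
  -- The index set of the direct sum must lie in the universe of the carriers; countability allows
  -- this.
  let e := equivShrink.{w} {H : Subgroup Γ // H.FG}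
  obtain ⟨δ, hδ, hs⟩ := h.exists_uniform_scatteredWith hfin
    (fun j (h : (e.symm j).1) => a (e.symm j) * (h : Γ))
    (fun j => isometry_mul_subgroup hΓ (e.symm j).1 (a (e.symm j)))
    (fun S hS => by
      obtain ⟨r, hr⟩ := hS.subset_closedBall 1
      obtain ⟨n, hn⟩ := exists_nat_ge r
      refine ((ha n).preimage e.symm.injective.injOn).subset ?_
      rintro j ⟨x, hx⟩
      exact ⟨x.1, x.2, Metric.closedBall_subset_closedBall hn (hr hx)⟩)
    (fun j => 𝓔 (e.symm j)) hD hd hb (fun _ => hE _) (fun _ => hE'' _) (fun _ => hf _)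
    (fun _ => hg _)
  refine ⟨δ, hδ, fun K => ?_⟩
  obtain ⟨j, rfl⟩ := e.symm.surjective K
  exact hs j

theorem weaklyCoarselyCoherent_of_coarselyCoherentFamily [IsNoetherianRing R] [Countable Γ]
    (hΓ : ∀ g x y : Γ, dist (g * x) (g * y) = dist x y)
    (hfin : ∀ S : Set Γ, Bornology.IsBounded S → S.Finite)
    (h : CoarselyCoherentFamily.{u, v, w, v} R
      (fun H : {H : Subgroup Γ // H.FG} => (H.1 : Type v))) :
    WeaklyCoarselyCoherent.{u, v, w} R Γ := by
  rintro 𝓔 ⟨b₁, hb₁, hf⟩ ⟨b₂, hb₂, hg⟩ ⟨D, hD, hE⟩ - ⟨d, hd, hE''⟩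
  set r := b₁ + b₂ + D + d
  have hr : 0 ≤ r := by positivity
  replace hf := hf.mono (b' := r) (by simp only [r]; linarith)
  replace hg := hg.mono (b' := r) (by simp only [r]; linarith)
  replace hE := hE.mono (D' := r) (by simp only [r]; linarith)
  replace hE'' := hE''.mono (d' := r) (by simp only [r]; linarith)
  obtain ⟨H, hBH, a, ha⟩ := exists_subgroup_and_representatives
    (hfin (Metric.closedBall 1 r) Metric.isBounded_closedBall)
  have hH : ∀ x y : Γ, dist x y ≤ r → x⁻¹ * y ∈ H := fun x y hxy => by
    refine hBH ?_
    rwa [Metric.mem_closedBall, ← hΓ x, mul_inv_cancel_left, mul_one, dist_comm]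
  -- The coset `a_K H`, or the empty set when `K` does not contain `H`, so that every index of the
  -- family carries a sequence.
  let C (K : {H : Subgroup Γ // H.FG}) : Set Γ := {x | H ≤ K.1 ∧ (a K)⁻¹ * x ∈ H}
  have hC : ∀ K, C K ⊆ Set.range fun h : K.1 => a K * (h : Γ) := fun K x hx =>
    ⟨⟨(a K)⁻¹ * x, hx.1 hx.2⟩, mul_inv_cancel_left _ _⟩
  have hCr : ∀ K, enlarge (C K) r ⊆ C K := by
    rintro K x ⟨y, ⟨hK, hy⟩, hxy⟩
    refine ⟨hK, ?_⟩
    simpa [mul_assoc] using H.mul_mem hy (hH y x (by rwa [dist_comm]))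
  have hi := fun K : {H : Subgroup Γ // H.FG} => isometry_mul_subgroup hΓ K.1 (a K)
  have hcomap := fun K => comap_le_fil_of_isBicontrolled 𝓔.injective hf (hCr K)
  have hmap := fun K => map_fil_le_of_isBicontrolled hg (hCr K)
  obtain ⟨δ, hδ, hs⟩ := h
    (fun K => restrictSeq 𝓔 _ (hi K) (C K) (hC K) (hcomap K) (hmap K)) r r r hr hr hr
    (fun K => restrict_leanWith (hi K) (hC K) (hCr K) _ hE)
    (fun K => restrict_insularWith (hi K) (hC K) (hCr K) _ _ (hmap K) hE'')
    (fun K => restrict_isBicontrolled (hi K) (hC K) (hCr K) (hcomap K) le_rfl (fun _ hm => hm)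
      (fun _ _ hm => hm) hf)
    (fun K => restrict_isBicontrolled (hi K) (hC K) (hCr K) le_rfl (hmap K)
      (fun _ hm => Submodule.mem_map_of_mem hm) (fun _ hm _ => hm) hg)
  refine ⟨δ, hδ, (FilteredModule.scatteredWith_iff _ _).2 ?_⟩
  refine eq_top_of_forall_comap_le 𝓔 (fun x : Γ => (x : Γ ⧸ H))
    (fun x y hxy => QuotientGroup.eq.2 (hH x y hxy)) hE hE'' hg _ fun q => ?_
  obtain ⟨g, rfl⟩ := QuotientGroup.mk_surjective q
  obtain ⟨K, hHK, hK⟩ := ha g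
  -- The subgroup `K` assigned to `g` satisfies `g ∈ a_K H`, so the fibre over `gH` is exactly `C
  -- K`.
  have hCK : (fun x : Γ => (x : Γ ⧸ H)) ⁻¹' {(g : Γ ⧸ H)} = C K := by
    ext x
    rw [Set.mem_preimage, Set.mem_singleton_iff, ← QuotientGroup.eq.2 hK, eq_comm, QuotientGroup.eq]
    exact (and_iff_right hHK).symm
  rw [hCK]
  exact le_iSup_of_restrict_scatteredWith (hi K) (hC K) (hN := hcomap K) (hs K)

end Main
end CoarseCoherence

theorem mainTheorem6 {R : Type u} [Ring R] [IsNoetherianRing R]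
    {Γ : Type v} [Group Γ] [Countable Γ] [MetricSpace Γ] [ProperSpace Γ] [DiscreteTopology Γ]
    (hΓ : ∀ g x y : Γ, dist (g * x) (g * y) = dist x y) :
    CoarseCoherence.WeaklyCoarselyCoherent.{u, v, w} R Γ ↔
      CoarseCoherence.CoarselyCoherentFamily.{u, v, w, v} R
        (fun H : {H : Subgroup Γ // H.FG} => (H.1 : Type v)) := by
  have hfin : ∀ S : Set Γ, Bornology.IsBounded S → S.Finite := fun S hS =>
    (hS.isCompact_closure.finite_of_discrete).subset subset_closure
  exact ⟨CoarseCoherence.coarselyCoherentFamily_of_weaklyCoarselyCoherent hΓ hfin,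
    CoarseCoherence.weaklyCoarselyCoherent_of_coarselyCoherentFamily hΓ hfin⟩
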